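/- Call a path on the rectangular grid (the graph on $\mathbb{Z}^2$ in which points at distance $1$ are joined by a grid edge) nontrivial if it has at least one grid edge. A nontrivial grid path is of shape $\llcorner$ if it consists of a vertical leg going up and a horizontal leg going right from a common grid point; one of the two legs may have length $0$, so vertical and horizontal segments are allowed. A graph $G$ is $\llcorner$-EPG if there is a family of pairwise different nontrivial grid paths $(P_v)_{v\in V(G)}$ of shape $\llcorner$ such that distinct vertices $u,v$ are adjacent in $G$ if and only if $P_u$ and $P_v$ share at least one grid edge. A graph is biconnected if it is connected and the deletion of any single vertex does not disconnect it (so $K_1$ and $K_2$ are biconnected); a block of $G$ is a maximal biconnected subgraph of $G$; and $G$ is a block graph if every block of $G$ is a clique. Corollary. Every finite block graph is $\llcorner$-EPG. In particular, every finite tree is a block graph, and hence is $\llcorner$-EPG. -/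

import Mathlib

namespace EPG

/-- The rectangular grid: grid points are the integer points of the plane, and two of them are
joined by a grid edge iff they are at distance one in a horizontal or vertical direction. -/
noncomputable def grid : SimpleGraph (ℤ × ℤ) :=
  (SimpleGraph.hasse ℤ).boxProd (SimpleGraph.hasse ℤ)

/-- A nontrivial path (no repeated grid point, at least one grid edge) on the grid. -/
structure GridPath where
  source : ℤ × ℤ
  target : ℤ × ℤ
  walk : grid.Walk source target
  isPath : walk.IsPath
  nontrivial : 0 < walk.length

/-- The set of grid edges used by a path. -/
def GridPath.edgeSet (P : GridPath) : Set (Sym2 (ℤ × ℤ)) :=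
  {e | e ∈ P.walk.edges}

/-- The vertical leg with lower end `c` and length `a`: the grid edges going `a` steps up
from `c`. -/
def verticalLeg (c : ℤ × ℤ) (a : ℕ) : Set (Sym2 (ℤ × ℤ)) :=
  {e | ∃ i : ℕ, i < a ∧ e = s((c.1, c.2 + i), (c.1, c.2 + i + 1))}

/-- The horizontal leg with left end `c` and length `b`: the grid edges going `b` steps to the
right from `c`. -/
def horizontalLeg (c : ℤ × ℤ) (b : ℕ) : Set (Sym2 (ℤ × ℤ)) :=
  {e | ∃ j : ℕ, j < b ∧ e = s((c.1 + j, c.2), (c.1 + j + 1, c.2))}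

/-- The shape `⌞`: a vertical leg going up and a horizontal leg going right from a common
point `c`. One of the two lengths may be zero, so that vertical and horizontal segments are
allowed; both cannot be zero since the path is nontrivial. -/
def GridPath.IsLShaped (P : GridPath) : Prop :=
  ∃ (c : ℤ × ℤ) (a b : ℕ), P.edgeSet = verticalLeg c a ∪ horizontalLeg c b

/-- The edge intersection graph of a family of grid paths: two distinct members of the family are
adjacent iff the paths share at least one grid edge. -/
def edgeIntersectionGraph {ι : Type*} (P : ι → GridPath) : SimpleGraph ι where
  Adj i j := i ≠ j ∧ ((P i).edgeSet ∩ (P j).edgeSet).Nonempty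
  symm := ⟨fun _ _ h => ⟨h.1.symm, by rw [Set.inter_comm]; exact h.2⟩⟩
  loopless := ⟨fun _ h => h.1 rfl⟩

/-- `G` is `⌞`-EPG: it is the edge intersection graph of a family of `⌞`-shaped paths on the grid,
with pairwise different paths for different vertices (so that the set of paths can be taken as
the vertex set). -/
def IsLEPG {V : Type*} (G : SimpleGraph V) : Prop :=
  ∃ P : V → GridPath, Function.Injective (fun v => (P v).edgeSet) ∧
    (∀ v, (P v).IsLShaped) ∧ edgeIntersectionGraph P = G

/-- `v` is a cut vertex of the (connected) graph `G`: the graph `G - v` is disconnected. -/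
def IsCutVertex {V : Type*} (G : SimpleGraph V) (v : V) : Prop :=
  ¬ (G.induce {v}ᶜ).Preconnected

/-- A biconnected graph: connected, without cut vertices. The graphs with a single vertex and
with two adjacent vertices are included, as usual for blocks. -/
def IsBiconnected {V : Type*} (G : SimpleGraph V) : Prop :=
  G.Connected ∧ ∀ v, ¬ IsCutVertex G v

/-- A block of `G` is a maximal biconnected subgraph of `G`. -/
def IsBlock {V : Type*} (G : SimpleGraph V) (B : G.Subgraph) : Prop :=
  Maximal (fun H : G.Subgraph => IsBiconnected H.coe) B

/-- A block graph: every block is a clique. -/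
def IsBlockGraph {V : Type*} (G : SimpleGraph V) : Prop :=
  ∀ B : G.Subgraph, IsBlock G B → G.IsClique B.verts

end EPG

namespace EPG

open SimpleGraph

/-! ### Cycles lie in blocks; trees are block graphs. -/

section BlockGraphs

variable {V : Type*} {G : SimpleGraph V}

/-! Root every component and let the level be the distance to the root. Two neighbours of `u` joined
by a walk avoiding `u` lie on a cycle, hence in one block, hence are adjacent
(`IsBlockGraph.adj_of_walk`). So each non-root vertex has a unique parent one level down, adjacency
within a level is transitive, and such siblings share their parent: every edge is a parent or a
sibling edge.

Each vertex gets its own grid line, with direction given by the parity of its level. Its path runs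
far along that line and also covers a short stretch of its parent's line, which yields the parent
edges. Line numbers are grouped by sibling class: stretches on the same line overlap within a class
and are disjoint between classes, which yields exactly the sibling edges. -/

/-- A walk inside a vertex set `S` is a walk of the subgraph induced by `S`. -/
theorem reachable_induce_of_walk {S : Set V} {x y : V} (w : G.Walk x y)
    (hw : ∀ t ∈ w.support, t ∈ S) (hx : x ∈ S) (hy : y ∈ S) :
    ((⊤ : G.Subgraph).induce S).coe.Reachable ⟨x, hx⟩ ⟨y, hy⟩ := by
  induction w with
  | nil => exact Reachable.refl _
  | @cons a b c hab w ih =>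
    have hb : b ∈ S := hw b (by simp)
    refine Reachable.trans (Adj.reachable ?_) (ih (fun t ht => hw t (by simp [ht])) hb hy)
    simpa using ⟨hx, hb, hab⟩

/-- A walk inside a vertex set `S` avoiding `v` is a walk of the subgraph induced by `S` from
which `v` is deleted. -/
theorem reachable_induce_compl_of_walk {S : Set V} {x y : V} (w : G.Walk x y)
    (v : ((⊤ : G.Subgraph).induce S).verts)
    (hw : ∀ t ∈ w.support, t ∈ S ∧ t ≠ v) (hx : x ∈ S) (hy : y ∈ S)
    (hxv : (⟨x, hx⟩ : ((⊤ : G.Subgraph).induce S).verts) ∈ ({v}ᶜ : Set _))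
    (hyv : (⟨y, hy⟩ : ((⊤ : G.Subgraph).induce S).verts) ∈ ({v}ᶜ : Set _)) :
    (((⊤ : G.Subgraph).induce S).coe.induce {v}ᶜ).Reachable ⟨⟨x, hx⟩, hxv⟩ ⟨⟨y, hy⟩, hyv⟩ := by
  induction w with
  | nil => exact Reachable.refl _
  | @cons a b c hab w ih =>
    have hb : b ∈ S ∧ b ≠ v := hw b (by simp)
    have hbv : (⟨b, hb.1⟩ : ((⊤ : G.Subgraph).induce S).verts) ∈ ({v}ᶜ : Set _) :=
      fun h => hb.2 (congrArg Subtype.val h)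
    refine Reachable.trans (Adj.reachable ?_) (ih (fun t ht => hw t (by simp [ht])) hb.1 hy hbv hyv)
    simpa using ⟨hx, hb.1, hab⟩

theorem isBiconnected_induce {S : Set V} (hne : S.Nonempty)
    (hconn : ∀ x ∈ S, ∀ y ∈ S, ∃ w : G.Walk x y, ∀ t ∈ w.support, t ∈ S)
    (hcut : ∀ z ∈ S, ∀ x ∈ S, ∀ y ∈ S, x ≠ z → y ≠ z →
      ∃ w : G.Walk x y, ∀ t ∈ w.support, t ∈ S ∧ t ≠ z) :
    IsBiconnected ((⊤ : G.Subgraph).induce S).coe := by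
  refine ⟨?_, fun v hv => hv ?_⟩
  · have : Nonempty ((⊤ : G.Subgraph).induce S).verts := hne.to_subtype
    refine ⟨?_⟩
    rintro ⟨x, hx⟩ ⟨y, hy⟩
    obtain ⟨w, hw⟩ := hconn x hx y hy
    exact reachable_induce_of_walk w hw hx hy
  · rintro ⟨⟨x, hx⟩, hxv⟩ ⟨⟨y, hy⟩, hyv⟩
    obtain ⟨w, hw⟩ := hcut v v.2 x hx y hy (fun h => hxv (Subtype.ext h))
      (fun h => hyv (Subtype.ext h))
    exact reachable_induce_compl_of_walk w v hw hx hy hxv hyv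

/-- A vertex adjacent to both ends of a path avoiding it closes the path to a cycle, which is
biconnected. -/
theorem isBiconnected_induce_insert_support {u p q : V} (hp : G.Adj u p) (hq : G.Adj u q)
    (w : G.Walk p q) (hw : w.IsPath) (hu : u ∉ w.support) :
    IsBiconnected ((⊤ : G.Subgraph).induce (insert u {t | t ∈ w.support})).coe := by
  classical
  set S : Set V := insert u {t | t ∈ w.support} with hS
  have hub : ∀ z ∈ S, z ≠ u → ∀ x ∈ S, x ≠ z →
      ∃ r : G.Walk x u, ∀ t ∈ r.support, t ∈ S ∧ t ≠ z := by
    intro z _ hzu x hx hxz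
    rcases hx with rfl | hx
    · exact ⟨Walk.nil, by simp [hS, hzu.symm]⟩
    obtain ⟨w₁, w₂, h⟩ := Walk.mem_support_iff_exists_append.1 hx
    -- A path visits `z` at most once, so one of the two halves from `x` misses `z`; its end is a
    -- neighbour of `u`.
    by_cases hz : z ∈ w₁.support
    · refine ⟨w₂.concat hq.symm, fun t ht => ?_⟩
      simp only [Walk.support_concat, List.mem_append,
        List.mem_singleton] at ht
      rcases ht with ht | rfl
      · refine ⟨Or.inr (by simp [h, ht]), ?_⟩
        rintro rfl
        exact (h ▸ hw).ne_of_mem_support_of_append hxz.symm hz ht rfl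
      · exact ⟨Or.inl rfl, hzu.symm⟩
    · refine ⟨w₁.reverse.concat hp.symm, fun t ht => ?_⟩
      simp only [Walk.support_concat, List.mem_append,
        List.mem_singleton, Walk.support_reverse, List.mem_reverse] at ht
      rcases ht with ht | rfl
      · refine ⟨Or.inr (by simp [h, ht]), ?_⟩
        rintro rfl
        exact hz ht
      · exact ⟨Or.inl rfl, hzu.symm⟩
  have hrim : ∀ x ∈ w.support, ∃ r : G.Walk x p, ∀ t ∈ r.support, t ∈ w.support := by
    intro x hx
    obtain ⟨w₁, w₂, h⟩ := Walk.mem_support_iff_exists_append.1 hx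
    exact ⟨w₁.reverse, fun t ht => by
      rw [h, Walk.mem_support_append_iff]; left; simpa using ht⟩
  have hall : ∀ x ∈ S, ∃ r : G.Walk x p, ∀ t ∈ r.support, t ∈ S := by
    rintro x (rfl | hx)
    · exact ⟨hp.toWalk, by simp [hS]⟩
    · obtain ⟨r, hr⟩ := hrim x hx
      exact ⟨r, fun t ht => Or.inr (hr t ht)⟩
  refine isBiconnected_induce ⟨u, Or.inl rfl⟩ (fun x hx y hy => ?_)
    fun z hz x hx y hy hxz hyz => ?_
  · obtain ⟨r, hr⟩ := hall x hx
    obtain ⟨s, hs⟩ := hall y hy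
    refine ⟨r.append s.reverse, fun t ht => ?_⟩
    rw [Walk.mem_support_append_iff, Walk.support_reverse, List.mem_reverse] at ht
    exact ht.elim (hr t) (hs t)
  · by_cases hzu : z = u
    · subst hzu
      obtain ⟨r, hr⟩ := hrim x (hx.resolve_left hxz)
      obtain ⟨s, hs⟩ := hrim y (hy.resolve_left hyz)
      refine ⟨r.append s.reverse, fun t ht => ?_⟩
      rw [Walk.mem_support_append_iff, Walk.support_reverse, List.mem_reverse] at ht
      have := ht.elim (hr t) (hs t)
      exact ⟨Or.inr this, fun h => hu (h ▸ this)⟩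
    · obtain ⟨r, hr⟩ := hub z hz hzu x hx hxz
      obtain ⟨s, hs⟩ := hub z hz hzu y hy hyz
      refine ⟨r.append s.reverse, fun t ht => ?_⟩
      rw [Walk.mem_support_append_iff, Walk.support_reverse, List.mem_reverse] at ht
      exact ht.elim (hr t) (hs t)

/-- In a block graph, two neighbours of `u` that are joined by a walk avoiding `u` are adjacent. -/
theorem IsBlockGraph.adj_of_walk [Finite V] (h : IsBlockGraph G) {u p q : V} (hp : G.Adj u p)
    (hq : G.Adj u q) (hpq : p ≠ q) (w : G.Walk p q) (hu : u ∉ w.support) : G.Adj p q := by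
  classical
  have hb := isBiconnected_induce_insert_support hp hq w.bypass w.bypass_isPath
    (fun h => hu (w.support_bypass_subset_support h))
  -- By finiteness the cycle lies in a maximal biconnected subgraph, that is, in a block.
  obtain ⟨B, hle, hB⟩ := (Set.toFinite {H : G.Subgraph | IsBiconnected H.coe}).exists_le_maximal hb
  exact h B hB (hle.1 (Or.inr w.bypass.start_mem_support))
    (hle.1 (Or.inr w.bypass.end_mem_support)) hpq

/-- In a tree, every biconnected subgraph is a clique. -/
theorem isBlockGraph_of_isTree (hG : G.IsTree) : IsBlockGraph G := by
  classical
  intro B hB a ha b hb hab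
  by_contra hnadj
  obtain ⟨w, hw⟩ := (hB.prop.1.preconnected ⟨a, ha⟩ ⟨b, hb⟩).exists_isPath
  cases w with
  | nil => exact hab rfl
  | @cons _ c _ hac w =>
    -- `c` is interior to the path from `a` to `b`. Deleting `c` keeps `B` connected, so a second
    -- path misses `c`, against uniqueness of paths in a tree.
    have hcb : c ≠ ⟨b, hb⟩ := by
      rintro rfl
      exact hnadj (B.adj_sub hac)
    have hca : c ≠ ⟨a, ha⟩ := hac.ne'
    have hcut : (B.coe.induce {c}ᶜ).Preconnected := not_not.1 (hB.prop.2 c)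
    obtain ⟨r, hr⟩ := (hcut ⟨⟨a, ha⟩, hca.symm⟩ ⟨⟨b, hb⟩, hcb.symm⟩).exists_isPath
    let f : B.coe.induce {c}ᶜ →g G := B.hom.comp (Embedding.induce _).toHom
    have hf : Function.Injective f := Subtype.val_injective.comp Subtype.val_injective
    have h₁ := Walk.IsPath.map hf hr
    have h₂ := Walk.IsPath.map B.hom_injective hw
    have heq := (hG.existsUnique_path a b).unique h₁ h₂
    have hc : (c : V) ∈ ((Walk.cons hac w).map B.hom).support := by
      rw [Walk.support_map]
      exact List.mem_map.2 ⟨c, by simp, rfl⟩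
    rw [← heq] at hc
    obtain ⟨x, -, hx⟩ := List.mem_map.1 (Walk.support_map f r ▸ hc)
    exact x.2 (Subtype.ext hx)

/-! ### Levels, parents and siblings. -/

/-- The distance of a vertex from a chosen root of its connected component. -/
noncomputable def level (G : SimpleGraph V) (v : V) : ℕ :=
  G.dist (G.connectedComponentMk v).out v

theorem reachable_root (v : V) : G.Reachable (G.connectedComponentMk v).out v :=
  ConnectedComponent.exact (Quot.out_eq _)

theorem root_eq_of_adj {u v : V} (h : G.Adj u v) :
    G.connectedComponentMk u = G.connectedComponentMk v :=
  ConnectedComponent.sound h.reachable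

theorem level_le_of_adj {u v : V} (h : G.Adj u v) : level G v ≤ level G u + 1 := by
  obtain ⟨w, hw⟩ := (reachable_root (G := G) u).exists_walk_length_eq_dist
  unfold level
  rw [← root_eq_of_adj h, ← hw]
  simpa using dist_le (w.concat h)

theorem eq_root_of_level_eq_zero {v : V} (h : level G v = 0) :
    (G.connectedComponentMk v).out = v :=
  (reachable_root v).dist_eq_zero_iff.1 h

theorem eq_of_level_eq_zero {u v : V} (hu : level G u = 0) (hv : level G v = 0)
    (h : G.connectedComponentMk u = G.connectedComponentMk v) : u = v := by
  rw [← eq_root_of_level_eq_zero hu, ← eq_root_of_level_eq_zero hv, h]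

theorem exists_parent {v : V} (h : level G v ≠ 0) : ∃ p, G.Adj v p ∧ level G p + 1 = level G v := by
  obtain ⟨w, hw⟩ := (reachable_root (G := G) v).symm.exists_walk_length_eq_dist
  have hlv : level G v = w.length := by rw [hw, dist_comm, level]
  generalize hr : (G.connectedComponentMk v).out = r at w hw
  cases w with
  | nil => exact absurd hlv h
  | @cons _ p _ hp w =>
    refine ⟨p, hp, le_antisymm ?_ (level_le_of_adj hp.symm)⟩
    have h1 : level G p ≤ w.length := by
      unfold level
      rw [dist_comm, ← root_eq_of_adj hp, hr]
      exact dist_le w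
    rw [Walk.length_cons] at hlv
    omega

/-- Every vertex is joined to its root by a walk through lower levels. -/
theorem exists_walk_root (v : V) : ∃ w : G.Walk v (G.connectedComponentMk v).out,
    ∀ t ∈ w.support, t = v ∨ level G t < level G v := by
  induction hn : level G v using Nat.strong_induction_on generalizing v with
  | _ n ih =>
    by_cases h0 : level G v = 0
    · exact ⟨Walk.nil.copy rfl (eq_root_of_level_eq_zero h0).symm, by simp⟩
    · obtain ⟨p, hp, hl⟩ := exists_parent h0
      obtain ⟨w, hw⟩ := ih (level G p) (by omega) p rfl
      refine ⟨(Walk.cons hp w).copy rfl (by rw [root_eq_of_adj hp]), fun t ht => ?_⟩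
      simp only [Walk.support_copy, Walk.support_cons, List.mem_cons] at ht
      rcases ht with rfl | ht
      · exact Or.inl rfl
      · right
        rcases hw t ht with rfl | h <;> omega

/-- Two vertices of a component are joined by a walk avoiding any other vertex of at least the
same level. -/
theorem exists_walk_avoiding {u p q : V} (h : G.connectedComponentMk p = G.connectedComponentMk q)
    (hp : p ≠ u) (hq : q ≠ u) (hpl : level G p ≤ level G u) (hql : level G q ≤ level G u) :
    ∃ w : G.Walk p q, u ∉ w.support := by
  obtain ⟨r, hr⟩ := exists_walk_root (G := G) p
  obtain ⟨s, hs⟩ := exists_walk_root (G := G) q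
  refine ⟨r.append (s.reverse.copy (by rw [h]) rfl), fun hu => ?_⟩
  rw [Walk.mem_support_append_iff, Walk.support_copy, Walk.support_reverse,
    List.mem_reverse] at hu
  rcases hu with hu | hu
  · rcases hr u hu with h | h
    · exact hp h.symm
    · omega
  · rcases hs u hu with h | h
    · exact hq h.symm
    · omega

variable [Finite V]

/-- Both `v` and `p` reach the root without meeting `u`. This puts siblings on the line of a common
parent. -/
theorem IsBlockGraph.adj_parent_of_adj (h : IsBlockGraph G) {u v p : V} (huv : G.Adj u v)
    (hl : level G u = level G v) (hup : G.Adj u p) (hp : level G p + 1 = level G u) :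
    G.Adj v p := by
  have hvp : v ≠ p := by rintro rfl; omega
  obtain ⟨w, hw⟩ := exists_walk_avoiding (u := u) (p := v) (q := p)
    ((root_eq_of_adj huv).symm.trans (root_eq_of_adj hup)) huv.ne' hup.ne' (by omega) (by omega)
  exact h.adj_of_walk huv hup hvp w hw

/-- Two parents `p`, `q` would be adjacent, hence share a parent `r`. The walk `u`, `q`, `r` avoids
`p`, so `u` would be adjacent to `r`, two levels below it. -/
theorem IsBlockGraph.parent_unique (h : IsBlockGraph G) {u p q : V} (hup : G.Adj u p)
    (huq : G.Adj u q) (hp : level G p + 1 = level G u) (hq : level G q + 1 = level G u) :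
    p = q := by
  by_contra hpq
  obtain ⟨w, hw⟩ := exists_walk_avoiding (u := u) (p := p) (q := q)
    ((root_eq_of_adj hup).symm.trans (root_eq_of_adj huq)) hup.ne' huq.ne' (by omega) (by omega)
  have hadj := h.adj_of_walk hup huq hpq w hw
  by_cases h0 : level G p = 0
  · exact hpq (eq_of_level_eq_zero h0 (by omega) (root_eq_of_adj hadj))
  obtain ⟨r, hpr, hr⟩ := exists_parent h0
  have hqr := h.adj_parent_of_adj hadj (by omega) hpr hr
  have hur : u ≠ r := by rintro rfl; omega
  have := h.adj_of_walk hup.symm hpr hur (Walk.cons huq (Walk.cons hqr Walk.nil))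
    (by simp [hup.ne', hpq, hpr.ne])
  have := level_le_of_adj this.symm
  omega

/-- The common parent of the three vertices gives a detour from `u` to `w` around `v`. -/
theorem IsBlockGraph.adj_trans (h : IsBlockGraph G) {u v w : V} (huv : G.Adj u v)
    (hvw : G.Adj v w) (huw : u ≠ w) (hl : level G u = level G v) (hl' : level G v = level G w) :
    G.Adj u w := by
  by_cases h0 : level G v = 0
  · exact absurd (eq_of_level_eq_zero (by omega) h0 (root_eq_of_adj huv)) huv.ne
  obtain ⟨p, hvp, hp⟩ := exists_parent h0
  have hup := h.adj_parent_of_adj huv.symm hl.symm hvp hp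
  have hwp := h.adj_parent_of_adj hvw hl' hvp hp
  exact h.adj_of_walk huv.symm hvw huw (Walk.cons hup (Walk.cons hwp.symm Walk.nil))
    (by simp [huv.ne', hvw.ne, hvp.ne])

end BlockGraphs

end EPG
namespace EPG

open SimpleGraph

/-! ### L-shaped paths and their intersections. -/

section Grid

/-- The unit grid edge with number `i` on the vertical (`b = true`) or horizontal (`b = false`)
grid line with number `k`. -/
def lineEdge (b : Bool) (k i : ℤ) : Sym2 (ℤ × ℤ) :=
  bif b then s((k, i), (k, i + 1)) else s((i, k), (i + 1, k))

theorem lineEdge_inj {b b' : Bool} {k k' i i' : ℤ} :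
    lineEdge b k i = lineEdge b' k' i' ↔ b = b' ∧ k = k' ∧ i = i' := by
  constructor
  · intro h
    cases b <;> cases b' <;>
      simp only [lineEdge, cond_true, cond_false, Sym2.eq_iff, Prod.mk.injEq] at h <;>
      simp only [true_and, reduceCtorEq, false_and] <;> omega
  · rintro ⟨rfl, rfl, rfl⟩
    rfl

theorem grid_adj_right (x y : ℤ) : grid.Adj (x + 1, y) (x, y) := by
  simp [grid, boxProd_adj, hasse_adj, Order.covBy_add_one]

theorem grid_adj_up (x y : ℤ) : grid.Adj (x, y + 1) (x, y) := by
  simp [grid, boxProd_adj, hasse_adj, Order.covBy_add_one]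

/-- The walk starts at the far end, so induction prepends one edge; the support bound shows that the
new grid point is fresh. -/
theorem exists_horizontal_walk (x y : ℤ) (b : ℕ) :
    ∃ w : grid.Walk (x + b, y) (x, y), w.IsPath ∧ w.length = b ∧
      (∀ e, e ∈ w.edges ↔ e ∈ horizontalLeg (x, y) b) ∧
      ∀ z ∈ w.support, z.1 ≤ x + b ∧ z.2 = y := by
  induction b with
  | zero => exact ⟨Walk.nil.copy (by simp) rfl, by simp, by simp, by simp [horizontalLeg], by simp⟩
  | succ b ih =>
    obtain ⟨w, hw, hl, he, hs⟩ := ih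
    refine ⟨(Walk.cons (grid_adj_right (x + b) y) w).copy (by push_cast; ring_nf) rfl,
      ?_, ?_, ?_, ?_⟩
    · rw [Walk.isPath_copy, Walk.cons_isPath_iff]
      exact ⟨hw, fun h => by have := (hs _ h).1; simp at this⟩
    · simp [hl]
    · intro e
      rw [Walk.edges_copy, Walk.edges_cons, List.mem_cons, he]
      simp only [horizontalLeg, Set.mem_ofPred_eq, Nat.lt_succ_iff_lt_or_eq]
      constructor
      · rintro (h | ⟨j, hj, h⟩)
        · exact ⟨b, Or.inr rfl, h.trans Sym2.eq_swap⟩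
        · exact ⟨j, Or.inl hj, h⟩
      · rintro ⟨j, hj | rfl, h⟩
        · exact Or.inr ⟨j, hj, h⟩
        · exact Or.inl (h.trans Sym2.eq_swap)
    · intro z hz
      rw [Walk.support_copy, Walk.support_cons, List.mem_cons] at hz
      push_cast
      rcases hz with rfl | hz
      · exact ⟨by simp [add_assoc], rfl⟩
      · have := hs z hz
        exact ⟨by linarith [this.1], this.2⟩

theorem exists_L_walk (x y : ℤ) (a b : ℕ) :
    ∃ w : grid.Walk (x, y + a) (x + b, y), w.IsPath ∧ w.length = a + b ∧
      (∀ e, e ∈ w.edges ↔ e ∈ verticalLeg (x, y) a ∪ horizontalLeg (x, y) b) ∧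
      ∀ z ∈ w.support, z.2 ≤ y + a := by
  induction a with
  | zero =>
    obtain ⟨w, hw, hl, he, hs⟩ := exists_horizontal_walk x y b
    refine ⟨w.reverse.copy (by simp) rfl, by simpa using hw, by simp [hl], fun e => ?_,
      fun z hz => ?_⟩
    · simp [he, verticalLeg]
    · simp only [Walk.support_copy, Walk.support_reverse, List.mem_reverse] at hz
      simp [(hs z hz).2]
  | succ a ih =>
    obtain ⟨w, hw, hl, he, hs⟩ := ih
    refine ⟨(Walk.cons (grid_adj_up x (y + a)) w).copy (by push_cast; ring_nf) rfl,
      ?_, ?_, ?_, ?_⟩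
    · rw [Walk.isPath_copy, Walk.cons_isPath_iff]
      exact ⟨hw, fun h => by have := hs _ h; simp at this⟩
    · simp [hl]; ring
    · intro e
      rw [Walk.edges_copy, Walk.edges_cons, List.mem_cons, he, Set.mem_union, Set.mem_union,
        ← or_assoc]
      refine or_congr ?_ Iff.rfl
      simp only [verticalLeg, Set.mem_ofPred_eq, Nat.lt_succ_iff_lt_or_eq]
      constructor
      · rintro (h | ⟨j, hj, h⟩)
        · exact ⟨a, Or.inr rfl, h.trans Sym2.eq_swap⟩
        · exact ⟨j, Or.inl hj, h⟩
      · rintro ⟨j, hj | rfl, h⟩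
        · exact Or.inr ⟨j, hj, h⟩
        · exact Or.inl (h.trans Sym2.eq_swap)
    · intro z hz
      rw [Walk.support_copy, Walk.support_cons, List.mem_cons] at hz
      push_cast
      rcases hz with rfl | hz
      · simp [add_assoc]
      · linarith [hs z hz]

theorem mem_verticalLeg {x y : ℤ} {a : ℕ} {e : Sym2 (ℤ × ℤ)} :
    e ∈ verticalLeg (x, y) a ↔ ∃ i, y ≤ i ∧ i < y + a ∧ e = lineEdge true x i := by
  constructor
  · rintro ⟨i, hi, rfl⟩
    exact ⟨y + i, by omega, by omega, rfl⟩
  · rintro ⟨i, hi, hi', rfl⟩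
    refine ⟨(i - y).toNat, by omega, ?_⟩
    have : ((i - y).toNat : ℤ) = i - y := by omega
    simp [lineEdge, this]

theorem mem_horizontalLeg {x y : ℤ} {b : ℕ} {e : Sym2 (ℤ × ℤ)} :
    e ∈ horizontalLeg (x, y) b ↔ ∃ i, x ≤ i ∧ i < x + b ∧ e = lineEdge false y i := by
  constructor
  · rintro ⟨i, hi, rfl⟩
    exact ⟨x + i, by omega, by omega, rfl⟩
  · rintro ⟨i, hi, hi', rfl⟩
    refine ⟨(i - x).toNat, by omega, ?_⟩
    have : ((i - x).toNat : ℤ) = i - x := by omega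
    simp [lineEdge, this]

/-- The L-shaped path whose legs lie on the line `n` of direction `b`, from `m` to `N`, and on the
line `m` of the other direction, from `n` to `E`. -/
theorem exists_gridPath (b : Bool) {n m N E : ℤ} (hN : m < N) (hE : n < E) :
    ∃ P : GridPath, P.IsLShaped ∧ ∀ e, e ∈ P.edgeSet ↔
      (∃ i, m ≤ i ∧ i < N ∧ e = lineEdge b n i) ∨ ∃ i, n ≤ i ∧ i < E ∧ e = lineEdge (!b) m i := by
  have h1 : ((N - m).toNat : ℤ) = N - m := by omega
  have h2 : ((E - n).toNat : ℤ) = E - n := by omega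
  cases b with
  | true =>
    obtain ⟨w, hw, hl, he, -⟩ := exists_L_walk n m (N - m).toNat (E - n).toNat
    refine ⟨⟨_, _, w, hw, by omega⟩, ⟨(n, m), _, _, Set.ext he⟩, fun e => (he e).trans ?_⟩
    rw [Set.mem_union, mem_verticalLeg, mem_horizontalLeg, h1, h2]
    simp
  | false =>
    obtain ⟨w, hw, hl, he, -⟩ := exists_L_walk m n (E - n).toNat (N - m).toNat
    refine ⟨⟨_, _, w, hw, by omega⟩, ⟨(m, n), _, _, Set.ext he⟩, fun e => (he e).trans ?_⟩
    rw [Set.mem_union, mem_verticalLeg, mem_horizontalLeg, h1, h2, or_comm]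
    simp

/-- A numbering of the vertices that yields an L-shaped representation: vertex `v` gets its own
grid line `n v` of direction `b v`, and also uses the stretch from `n v` to `E v` of the line
numbered `m v` of the other direction. -/
theorem isLEPG_of_numbering {V : Type*} [Finite V] {G : SimpleGraph V} (b : V → Bool)
    (n m E : V → ℤ) (hn : Function.Injective n) (hm : ∀ v, m v < n v) (hE : ∀ v, n v < E v)
    (hadj : ∀ u v, u ≠ v → (G.Adj u v ↔ (n u = m v ∧ b u ≠ b v) ∨ (n v = m u ∧ b v ≠ b u) ∨
      (b u = b v ∧ m u = m v ∧ n u < E v ∧ n v < E u))) : IsLEPG G := by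
  -- All own legs end at `N`, beyond every short leg; the edge at `N - 1` therefore identifies the
  -- path.
  obtain ⟨N, hN⟩ : ∃ N, ∀ v, E v < N := by
    obtain ⟨N, hN⟩ := (Set.finite_range E).bddAbove
    exact ⟨N + 1, fun v => Int.lt_add_one_of_le (hN ⟨v, rfl⟩)⟩
  choose P hP he using fun v => exists_gridPath (b v) (n := n v) (m := m v) (N := N) (E := E v)
    (((hm v).trans (hE v)).trans (hN v)) (hE v)
  refine ⟨P, fun u v huv => ?_, hP, ?_⟩
  · have h1 : lineEdge (b u) (n u) (N - 1) ∈ (P u).edgeSet :=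
      (he u _).2 (Or.inl ⟨N - 1, by have := hm u; have := hE u; have := hN u; omega, by omega, rfl⟩)
    replace huv : (P u).edgeSet = (P v).edgeSet := huv
    rw [huv, he] at h1
    rcases h1 with ⟨i, -, -, h⟩ | ⟨i, -, hi, h⟩
    · exact hn (lineEdge_inj.1 h).2.1
    · have := (lineEdge_inj.1 h).2.2
      have := hN v
      omega
  · ext u v
    by_cases huv : u = v
    · subst huv
      simp
    have hnuv : n u ≠ n v := fun h => huv (hn h)
    have := hm u; have := hm v; have := hE u; have := hE v; have := hN u; have := hN v
    rw [hadj u v huv]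
    constructor
    · rintro ⟨-, e, hu, hv⟩
      rw [he] at hu hv
      -- Two own legs never meet; an own and a short leg meet only on the own line; two short legs
      -- meet only on a shared line.
      rcases hu with ⟨i, hi, hi', rfl⟩ | ⟨i, hi, hi', rfl⟩ <;>
        rcases hv with ⟨j, hj, hj', h⟩ | ⟨j, hj, hj', h⟩ <;>
        obtain ⟨h1, h2, rfl⟩ := lineEdge_inj.1 h
      · exact absurd h2 hnuv
      · exact Or.inl ⟨h2, by simp [h1]⟩
      · exact Or.inr (Or.inl ⟨h2.symm, by simp [← h1]⟩)
      · exact Or.inr (Or.inr ⟨by simpa using h1, h2, by omega, by omega⟩)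
    · rintro (⟨h1, h2⟩ | ⟨h1, h2⟩ | ⟨h1, h2, h3, h4⟩) <;> refine ⟨huv, ?_⟩
      -- The shared edge is the first one of the short leg of `v`; it lies on the own leg of `u`
      -- since `m u < n u = m v < n v`.
      · refine ⟨lineEdge (b u) (n u) (n v), (he u _).2 (Or.inl ⟨n v, by omega, by omega, rfl⟩),
          (he v _).2 (Or.inr ⟨n v, le_rfl, by omega, ?_⟩)⟩
        rw [h1, Bool.eq_not_of_ne h2]
      · refine ⟨lineEdge (b v) (n v) (n u), (he u _).2 (Or.inr ⟨n u, le_rfl, by omega, ?_⟩),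
          (he v _).2 (Or.inl ⟨n u, by omega, by omega, rfl⟩)⟩
        rw [h1, Bool.eq_not_of_ne h2]
      · refine ⟨lineEdge (!b u) (m u) (max (n u) (n v)),
          (he u _).2 (Or.inr ⟨_, by omega, by omega, rfl⟩),
          (he v _).2 (Or.inr ⟨max (n u) (n v), by omega, by omega, ?_⟩)⟩
        rw [h1, h2]

end Grid

end EPG
namespace EPG

open SimpleGraph

/-! ### Numbering by sibling classes. -/

section Numbering

variable {V : Type*} {G : SimpleGraph V}

/-- Vertices of the same level that are equal or adjacent: the pieces that the blocks of a rooted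
block graph leave after removing the vertex nearest to the root. -/
def IsBlockGraph.siblingSetoid [Finite V] (h : IsBlockGraph G) : Setoid V where
  r u v := u = v ∨ (level G u = level G v ∧ G.Adj u v)
  iseqv :=
    { refl := fun _ => Or.inl rfl
      symm := by
        rintro u v (rfl | ⟨h1, h2⟩)
        · exact Or.inl rfl
        · exact Or.inr ⟨h1.symm, h2.symm⟩
      trans := by
        rintro u v w (rfl | ⟨h1, h2⟩) h3
        · exact h3
        rcases h3 with rfl | ⟨h3, h4⟩
        · exact Or.inr ⟨h1, h2⟩
        by_cases huw : u = w
        · exact Or.inl huw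
        · exact Or.inr ⟨h1.trans h3, h.adj_trans h2 h4 huw h1 h3⟩ }

/-- The sibling classes of a block graph can be numbered compatibly with the levels. -/
theorem IsBlockGraph.exists_class_numbering [Finite V] (h : IsBlockGraph G) :
    ∃ Q : V → ℕ, (∀ u v, level G u < level G v → Q u < Q v) ∧
      ∀ u v, u ≠ v → (Q u = Q v ↔ level G u = level G v ∧ G.Adj u v) := by
  let s := h.siblingSetoid
  obtain ⟨M, ⟨f⟩⟩ := Finite.exists_equiv_fin (Quotient s)
  have hf : ∀ v, (f ⟦v⟧ : ℕ) < M := fun v => (f ⟦v⟧).2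
  have hlt : ∀ u v, level G u < level G v →
      level G u * M + f ⟦u⟧ < level G v * M + f ⟦v⟧ := by
    intro u v huv
    have := hf u
    have : (level G u + 1) * M ≤ level G v * M := Nat.mul_le_mul_right M huv
    rw [Nat.succ_mul] at this
    omega
  -- Lexicographic order: level first, then the index of the class, which is below `M`.
  refine ⟨fun v => level G v * M + f ⟦v⟧, hlt, fun u v huv => ⟨fun hQ => ?_, fun hr => ?_⟩⟩
  · have hl : level G u = level G v := by
      rcases lt_trichotomy (level G u) (level G v) with hl | hl | hl
      · exact absurd hQ (hlt u v hl).ne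
      · exact hl
      · exact absurd hQ (hlt v u hl).ne'
    have hQ' : level G u * M + (f ⟦u⟧ : ℕ) = level G v * M + f ⟦v⟧ := hQ
    rw [hl] at hQ'
    have hq : (⟦u⟧ : Quotient s) = ⟦v⟧ := f.injective (Fin.ext (by omega))
    exact (Quotient.exact hq).resolve_left huv
  · have hq : (⟦u⟧ : Quotient s) = ⟦v⟧ := Quotient.sound (Or.inr hr)
    simp only [hq, hr.1]

theorem IsBlockGraph.isLEPG [Finite V] (h : IsBlockGraph G) : IsLEPG G := by
  classical
  obtain ⟨Q, hQl, hQ⟩ := h.exists_class_numbering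
  obtain ⟨M, ⟨f⟩⟩ := Finite.exists_equiv_fin V
  have hf : ∀ v, (f v : ℕ) < M := fun v => (f v).2
  -- Class `Q` owns the window of `M` numbers from `Q * M + 1`, and `E` is the first number after
  -- it. The shift by one reserves line `0` for the short legs of the roots.
  let n : V → ℕ := fun v => Q v * M + f v + 1
  let E : V → ℕ := fun v => (Q v + 1) * M + 1
  let m : V → ℕ := fun v => if hv : level G v = 0 then 0 else n (exists_parent hv).choose
  have hnQ : ∀ u v, Q u < Q v → E u ≤ n v := by
    intro u v huv
    have : (Q u + 1) * M ≤ Q v * M := Nat.mul_le_mul_right M huv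
    simp only [n, E]
    omega
  have hE : ∀ v, n v < E v := by
    intro v
    have := hf v
    simp only [n, E, Nat.succ_mul]
    omega
  have hlt : ∀ u v, Q u < Q v → n u < n v := fun u v huv => (hE u).trans_le (hnQ u v huv)
  have hn : Function.Injective n := by
    intro u v huv
    have hq : Q u = Q v := by
      rcases lt_trichotomy (Q u) (Q v) with hq | hq | hq
      · exact absurd huv (hlt u v hq).ne
      · exact hq
      · exact absurd huv (hlt v u hq).ne'
    simp only [n, hq] at huv
    exact f.injective (Fin.ext (by omega))
  have hm0 : ∀ v, level G v = 0 → m v = 0 := fun v hv => dif_pos hv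
  have hmp : ∀ v, level G v ≠ 0 → ∃ p, G.Adj v p ∧ level G p + 1 = level G v ∧ m v = n p :=
    fun v hv => ⟨_, (exists_parent hv).choose_spec.1, (exists_parent hv).choose_spec.2, dif_neg hv⟩
  have hmadj : ∀ u v, n u = m v → G.Adj u v := by
    intro u v huv
    by_cases hv : level G v = 0
    · rw [hm0 v hv] at huv
      exact absurd huv (Nat.succ_ne_zero _)
    · obtain ⟨p, hp, -, hmv⟩ := hmp v hv
      rw [hn (huv.trans hmv)]
      exact hp.symm
  have hlow : ∀ u v, G.Adj u v → level G u < level G v →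
      n u = m v ∧ decide (Even (level G u)) ≠ decide (Even (level G v)) := by
    intro u v huv hl
    have hl' : level G u + 1 = level G v := le_antisymm hl (level_le_of_adj huv)
    obtain ⟨p, hp, hpl, hmv⟩ := hmp v (by omega)
    refine ⟨by rw [hmv, h.parent_unique huv.symm hp hl' hpl], ?_⟩
    rw [← hl', Ne, decide_eq_decide, Nat.even_add_one]
    tauto
  refine isLEPG_of_numbering (fun v => decide (Even (level G v))) (fun v => (n v : ℤ))
    (fun v => (m v : ℤ)) (fun v => (E v : ℤ)) (Nat.cast_injective.comp hn) (fun v => ?_)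
    (fun v => Nat.cast_lt.2 (hE v)) (fun u v huv => ?_)
  · refine Nat.cast_lt.2 ?_
    by_cases hv : level G v = 0
    · rw [hm0 v hv]
      exact Nat.succ_pos _
    · obtain ⟨p, -, hp, hmv⟩ := hmp v hv
      rw [hmv]
      exact hlt p v (hQl p v (by omega))
  · simp only [Nat.cast_inj, Nat.cast_lt]
    constructor
    · intro hadj
      rcases lt_trichotomy (level G u) (level G v) with hl | hl | hl
      · exact Or.inl (hlow u v hadj hl)
      · have hq := (hQ u v huv).2 ⟨hl, hadj⟩
        refine Or.inr (Or.inr ⟨by rw [hl], ?_, ?_, ?_⟩)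
        · by_cases hv : level G v = 0
          · rw [hm0 v hv, hm0 u (hl.trans hv)]
          · obtain ⟨p, hp, hpl, hmv⟩ := hmp v hv
            obtain ⟨q, hq, hql, hmu⟩ := hmp u (by omega)
            rw [hmv, hmu, h.parent_unique (h.adj_parent_of_adj hadj hl hq hql) hp (by omega) hpl]
        · have := hE u
          simp only [E, hq] at this ⊢
          exact this
        · have := hE v
          simp only [E, hq] at this ⊢
          exact this
      · exact Or.inr (Or.inl (hlow v u hadj.symm hl))
    · rintro (⟨h1, -⟩ | ⟨h1, -⟩ | ⟨-, -, h1, h2⟩)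
      · exact hmadj u v h1
      · exact (hmadj v u h1).symm
      · refine ((hQ u v huv).1 ?_).2
        -- Different classes have disjoint windows, so overlapping stretches force equal classes.
        rcases lt_trichotomy (Q u) (Q v) with hq | hq | hq
        · exact absurd h2 (hnQ u v hq).not_gt
        · exact hq
        · exact absurd h1 (hnQ v u hq).not_gt

end Numbering

end EPG

theorem mainTheorem3 {V : Type*} [Finite V] (G : SimpleGraph V) :
    (EPG.IsBlockGraph G → EPG.IsLEPG G) ∧
      (G.IsTree → EPG.IsBlockGraph G ∧ EPG.IsLEPG G) :=
  ⟨fun h => h.isLEPG, fun h =>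
    ⟨EPG.isBlockGraph_of_isTree h, (EPG.isBlockGraph_of_isTree h).isLEPG⟩⟩
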